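/- Let $R$ be a commutative ring with $1$. For an $R$-module $P$, its trace is the ideal $\mathrm{Tr}(P)=\sum_{f\in \mathrm{Hom}_R(P,R)} f(P)$ of $R$. An ideal $I$ of $R$ is called pure if $R/I$ is a flat $R$-module (equivalently, if $I$ is a pure submodule of $R$). "Countably generated" means generated by a countable, possibly finite or empty, set. Let $I$ be an ideal of $R$. 1. $I$ is the trace of a projective $R$-module if and only if $I$ is pure. 2. The following statements are equivalent: - (i) $I$ is the trace of a countably generated projective $R$-module; - (ii) $I$ is generated by a sequence $(a_n)_{n\in\mathbb N}$ of elements of $R$ such that $a_{n+1}a_n=a_n$ for every $n\in\mathbb N$; - (iii) $I$ is a countably generated pure ideal of $R$; - (iv) $I$ is a countably generated, projective and pure ideal of $R$. -/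

import Mathlib

universe u v

/-- The trace of an `R`-module `P` over a commutative ring `R`: the sum in `R` of the images of all
`R`-linear maps `P → R`. -/
def Module.traceIdeal (R : Type*) [CommRing R] (P : Type*) [AddCommGroup P] [Module R P] :
    Ideal R :=
  ⨆ f : P →ₗ[R] R, LinearMap.range f

/-- A submodule is countably generated if it is the span of a countable (possibly finite or empty)
set. -/
def Submodule.IsCountablyGenerated {R : Type*} [CommRing R] {M : Type*} [AddCommGroup M]
    [Module R M] (N : Submodule R M) : Prop :=
  ∃ s : Set M, s.Countable ∧ Submodule.span R s = N

/-!
Purity of `I` means that `I` has local units: every `x ∈ I` satisfies `t * x = x` for some `t ∈ I`.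

The trace `T` of a projective module `P` has local units by Nakayama's lemma. If `s` is a section of
the canonical surjection `(P →₀ R) → P`, then the coordinates `s x q = ∑ p, s x p * s p q` of a
fixed `x` span a finitely generated ideal `N` with `N ≤ T • N`, so some `r ∈ 1 + T` kills `N`, and
hence kills `f x` for every functional `f` (`Module.exists_mul_eq_self_of_mem_traceIdeal`).
If `P` is countably generated, the values of countably many coordinate functionals at countably many
generators span `T`.

Conversely, local units in `I` let one build sequences in `I` with `a (n + 1) * a n = a n`, starting
at any element of `I`, and generating `I` when `I` is countably generated. The ideal `J` spanned by
such a sequence is projective: every `x ∈ J` is fixed by `a n` for all large `n`, so the telescoping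
sum of the `(a n - a (n - 1)) * x` is finite with value `x`; as `a (n + 1)` fixes `a n - a (n - 1)`,
multiplication by these differences, together with the elements `a (n + 1)`, is a dual basis of `J`
(`Ideal.projective_span_range_of_succ_mul_eq`). A pure ideal is its own trace, and an arbitrary pure
ideal `I` is the trace of the direct sum of such projective ideals, one for each element of `I`.
-/

/-! ### Pure ideals and local units -/

theorem Ideal.pure_iff_forall_exists_mul_eq {R : Type*} [CommRing R] {I : Ideal R} :
    I.Pure ↔ ∀ x ∈ I, ∃ t ∈ I, t * x = x := by
  refine ⟨fun h x hx ↦ ?_, fun h ↦ Ideal.Pure.of_inf_eq_mul I fun J _ ↦ ?_⟩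
  · obtain ⟨t, ht, hxt⟩ := Ideal.exists_eq_mul_of_pure hx
    exact ⟨t, ht, by rw [mul_comm, ← hxt]⟩
  · refine le_antisymm (fun x hx ↦ ?_) Ideal.mul_le_inf
    obtain ⟨t, ht, htx⟩ := h x hx.1
    exact htx ▸ Ideal.mul_mem_mul ht hx.2

/-- The complement `1 - u` of a common local unit is the product of the complements `1 - t` and
`1 - t'`, where `t` fixes `x` and `t'` fixes `y`. -/
theorem Ideal.exists_mul_eq_and_mul_eq {R : Type*} [CommRing R] {I : Ideal R} {x y t t' : R}
    (ht : t ∈ I) (htx : t * x = x) (ht' : t' ∈ I) (hty : t' * y = y) :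
    ∃ u ∈ I, u * x = x ∧ u * y = y := by
  refine ⟨t + t' - t * t', I.sub_mem (I.add_mem ht ht') (I.mul_mem_right _ ht), ?_, ?_⟩
  · linear_combination (1 - t') * htx
  · linear_combination (1 - t) * hty

/-! ### Trace ideals -/

namespace Module

variable {R : Type*} [CommRing R]

theorem apply_mem_traceIdeal {P : Type*} [AddCommGroup P] [Module R P] (f : P →ₗ[R] R) (x : P) :
    f x ∈ traceIdeal R P :=
  le_iSup (fun f : P →ₗ[R] R ↦ LinearMap.range f) f ⟨x, rfl⟩

theorem traceIdeal_le_iff {P : Type*} [AddCommGroup P] [Module R P] {I : Ideal R} :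
    traceIdeal R P ≤ I ↔ ∀ (f : P →ₗ[R] R) (x : P), f x ∈ I := by
  refine ⟨fun h f x ↦ h (apply_mem_traceIdeal f x), fun h ↦ iSup_le fun f ↦ ?_⟩
  rintro _ ⟨x, rfl⟩
  exact h f x

theorem traceIdeal_congr {P Q : Type*} [AddCommGroup P] [Module R P] [AddCommGroup Q] [Module R Q]
    (e : P ≃ₗ[R] Q) : traceIdeal R P = traceIdeal R Q := by
  refine le_antisymm (traceIdeal_le_iff.2 fun f x ↦ ?_) (traceIdeal_le_iff.2 fun f x ↦ ?_)
  · simpa using apply_mem_traceIdeal (f ∘ₗ e.symm.toLinearMap) (e x)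
  · simpa using apply_mem_traceIdeal (f ∘ₗ e.toLinearMap) (e.symm x)

theorem traceIdeal_dfinsupp {ι : Type*} (M : ι → Type*) [∀ i, AddCommGroup (M i)]
    [∀ i, Module R (M i)] : traceIdeal R (Π₀ i, M i) = ⨆ i, traceIdeal R (M i) := by
  classical
  refine le_antisymm (traceIdeal_le_iff.2 fun f x ↦ ?_)
    (iSup_le fun i ↦ traceIdeal_le_iff.2 fun f x ↦ ?_)
  · induction x using DFinsupp.induction with
    | h0 => simp
    | ha i b g _ _ ih =>
      rw [map_add]
      exact Ideal.add_mem _ (Ideal.mem_iSup_of_mem i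
        (apply_mem_traceIdeal (f ∘ₗ DFinsupp.lsingle i) b)) ih
  · simpa using apply_mem_traceIdeal (f ∘ₗ DFinsupp.lapply i) (DFinsupp.single i x)

/-- A functional on a pure ideal has its values in the ideal, since `f x = f (t * x) = t * f x` for
a local unit `t` of `x`. -/
theorem traceIdeal_of_pure {I : Ideal R} (h : I.Pure) : traceIdeal R I = I := by
  refine le_antisymm (traceIdeal_le_iff.2 fun f x ↦ ?_) fun x hx ↦
    apply_mem_traceIdeal I.subtype ⟨x, hx⟩
  obtain ⟨t, ht, htx⟩ := Ideal.pure_iff_forall_exists_mul_eq.1 h x x.2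
  have hx : t • x = x := Subtype.ext htx
  rw [← hx, map_smul]
  exact I.mul_mem_right _ ht

theorem exists_mul_eq_self_of_mem_traceIdeal {P : Type*} [AddCommGroup P] [Module R P]
    [Projective R P] {y : R} (hy : y ∈ traceIdeal R P) :
    ∃ t ∈ traceIdeal R P, t * y = y := by
  rw [traceIdeal] at hy
  induction hy using Submodule.iSup_induction' with
  | zero => exact ⟨0, zero_mem _, by simp⟩
  | add x y _ _ hx hy =>
    obtain ⟨t, ht, htx⟩ := hx
    obtain ⟨t', ht', hty⟩ := hy
    obtain ⟨u, hu, hux, huy⟩ := Ideal.exists_mul_eq_and_mul_eq ht htx ht' hty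
    exact ⟨u, hu, by rw [mul_add, hux, huy]⟩
  | mem f y hy =>
    obtain ⟨x, rfl⟩ := hy
    obtain ⟨s, hs⟩ := projective_def.1 ‹Projective R P›
    have hsum (g : P →ₗ[R] R) : g x = ∑ p ∈ (s x).support, s x p * g p := by
      conv_lhs => rw [← hs x]
      simp [Finsupp.linearCombination_apply, Finsupp.sum]
    let N : Ideal R := Ideal.span (s x '' (s x).support)
    have hN {p : P} (hp : p ∈ (s x).support) : s x p ∈ N := Ideal.subset_span ⟨p, hp, rfl⟩
    have hNfg : N.FG := Submodule.fg_span ((s x).support.finite_toSet.image _)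
    have hle : N ≤ traceIdeal R P • N := by
      refine Ideal.span_le.2 ?_
      rintro _ ⟨q, -, rfl⟩
      rw [show s x q = (Finsupp.lapply q ∘ₗ s) x from rfl, hsum]
      refine Submodule.sum_mem _ fun p hp ↦ ?_
      rw [mul_comm]
      exact Submodule.smul_mem_smul (apply_mem_traceIdeal _ p) (hN hp)
    obtain ⟨r, hr, hrN⟩ :=
      Submodule.exists_sub_one_mem_and_smul_eq_zero_of_fg_of_le_smul _ N hNfg hle
    refine ⟨1 - r, by simpa using neg_mem hr, ?_⟩
    have : r * f x = 0 := by
      rw [hsum, Finset.mul_sum]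
      refine Finset.sum_eq_zero fun p hp ↦ ?_
      have := hrN _ (hN hp)
      rw [smul_eq_mul] at this
      rw [← mul_assoc, this, zero_mul]
    rw [sub_mul, this, one_mul, sub_zero]

theorem pure_traceIdeal_of_projective (P : Type*) [AddCommGroup P] [Module R P] [Projective R P] :
    (traceIdeal R P).Pure :=
  Ideal.pure_iff_forall_exists_mul_eq.2 fun _ ↦ exists_mul_eq_self_of_mem_traceIdeal

theorem isCountablyGenerated_traceIdeal {P : Type*} [AddCommGroup P] [Module R P] [Projective R P]
    (h : (⊤ : Submodule R P).IsCountablyGenerated) : (traceIdeal R P).IsCountablyGenerated := by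
  obtain ⟨S, hS, hspan⟩ := h
  have hsurj : LinearMap.range (Finsupp.linearCombination R ((↑) : S → P)) = ⊤ := by
    rw [Finsupp.range_linearCombination, Subtype.range_coe, hspan]
  obtain ⟨s, hs⟩ := LinearMap.exists_rightInverse_of_surjective _ hsurj
  have := hS.to_subtype
  refine ⟨Set.range fun ij : S × S ↦ s ij.1 ij.2, Set.countable_range _, le_antisymm ?_ ?_⟩
  · refine Ideal.span_le.2 ?_
    rintro _ ⟨⟨i, j⟩, rfl⟩
    exact apply_mem_traceIdeal (Finsupp.lapply j ∘ₗ s) i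
  · -- The coordinates of every `x : P`, not only of the generators, lie in the span.
    have hcoord (x : P) (j : S) :
        s x j ∈ Ideal.span (Set.range fun ij : S × S ↦ s ij.1 ij.2) := by
      have hx : x ∈ Submodule.span R S := hspan ▸ Submodule.mem_top
      induction hx using Submodule.span_induction with
      | mem x hx => exact Ideal.subset_span ⟨(⟨x, hx⟩, j), rfl⟩
      | zero => simp
      | add x y _ _ hx hy => simpa using Ideal.add_mem _ hx hy
      | smul r x _ hx => simpa using Ideal.mul_mem_left _ r hx
    refine traceIdeal_le_iff.2 fun f x ↦ ?_
    rw [← LinearMap.id_apply (R := R) x, ← hs, LinearMap.comp_apply,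
      Finsupp.linearCombination_apply, Finsupp.sum, map_sum]
    refine Submodule.sum_mem _ fun j _ ↦ ?_
    rw [map_smul]
    exact Ideal.mul_mem_right _ _ (hcoord x j)

end Module

/-! ### Ideals spanned by a sequence of successive local units -/

namespace Ideal

variable {R : Type*} [CommRing R] {a : ℕ → R}

theorem mul_eq_of_succ_mul_eq (ha : ∀ n, a (n + 1) * a n = a n) {m n : ℕ} (h : m < n) :
    a n * a m = a m := by
  induction n, h using Nat.le_induction with
  | base => exact ha m
  | succ n _ ih => rw [← ih, ← mul_assoc, ha n]

theorem exists_forall_mul_eq_of_mem_span_range (ha : ∀ n, a (n + 1) * a n = a n) {x : R}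
    (hx : x ∈ span (Set.range a)) : ∃ N, ∀ n, N ≤ n → a n * x = x := by
  induction hx using Submodule.span_induction with
  | mem x hx =>
    obtain ⟨m, rfl⟩ := hx
    exact ⟨m + 1, fun n hn ↦ mul_eq_of_succ_mul_eq ha hn⟩
  | zero => exact ⟨0, by simp⟩
  | add x y _ _ hx hy =>
    obtain ⟨N, hN⟩ := hx
    obtain ⟨M, hM⟩ := hy
    refine ⟨max N M, fun n hn ↦ ?_⟩
    rw [mul_add, hN n (le_of_max_le_left hn), hM n (le_of_max_le_right hn)]
  | smul r x _ hx =>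
    obtain ⟨N, hN⟩ := hx
    exact ⟨N, fun n hn ↦ by rw [mul_smul_comm, hN n hn]⟩

theorem pure_span_range_of_succ_mul_eq (ha : ∀ n, a (n + 1) * a n = a n) :
    (span (Set.range a)).Pure := by
  refine pure_iff_forall_exists_mul_eq.2 fun x hx ↦ ?_
  obtain ⟨N, hN⟩ := exists_forall_mul_eq_of_mem_span_range ha hx
  exact ⟨a N, subset_span ⟨N, rfl⟩, hN N le_rfl⟩

theorem projective_span_range_of_succ_mul_eq (ha : ∀ n, a (n + 1) * a n = a n) :
    Module.Projective R (span (Set.range a)) := by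
  -- The index is shifted by one: `a n - a (n - 1)` is encoded as `c (n + 1) - c n`, with `c 0 = 0`.
  let c : ℕ → R := fun n ↦ n.casesOn 0 a
  have hsub (n : ℕ) : a (n + 1) * (c (n + 1) - c n) = c (n + 1) - c n := by
    cases n with
    | zero => simp [c, ha 0]
    | succ n => simp only [c, mul_sub, ha (n + 1), mul_eq_of_succ_mul_eq ha (show n < n + 2 by lia)]
  have hfin (x : span (Set.range a)) : ∃ N, ∀ n, N ≤ n → c n * x = x := by
    obtain ⟨N, hN⟩ := exists_forall_mul_eq_of_mem_span_range ha x.2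
    refine ⟨N + 1, fun n hn ↦ ?_⟩
    obtain ⟨n, rfl⟩ := Nat.exists_eq_succ_of_ne_zero (show n ≠ 0 by lia)
    exact hN n (by lia)
  have hzero {x : R} {N : ℕ} (hN : ∀ n, N ≤ n → c n * x = x) {n : ℕ} (hn : N ≤ n) :
      (c (n + 1) - c n) * x = 0 := by
    rw [sub_mul, hN n hn, hN (n + 1) (by lia), sub_self]
  have hsupp (x : span (Set.range a)) :
      (Function.support fun n ↦ (c (n + 1) - c n) * (x : R)).Finite := by
    obtain ⟨N, hN⟩ := hfin x
    refine (Set.finite_lt_nat N).subset fun n hn ↦ ?_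
    by_contra h
    exact hn (hzero hN (not_lt.1 h))
  let s : span (Set.range a) →ₗ[R] ℕ →₀ R :=
    { toFun x := Finsupp.ofSupportFinite _ (hsupp x)
      map_add' x y := by ext n; exact mul_add _ _ _
      map_smul' r x := by ext n; exact mul_left_comm _ _ _ }
  let π : (ℕ →₀ R) →ₗ[R] span (Set.range a) :=
    Finsupp.linearCombination R fun n ↦ ⟨a (n + 1), subset_span ⟨n + 1, rfl⟩⟩
  refine Module.Projective.of_split s π (LinearMap.ext fun x ↦ Subtype.ext ?_)
  obtain ⟨N, hN⟩ := hfin x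
  have hsN : (s x).support ⊆ Finset.range N := fun n hn ↦ by
    by_contra h
    exact Finsupp.mem_support_iff.1 hn (hzero hN (by simpa using h))
  have hterm (n : ℕ) : s x n * a (n + 1) = (c (n + 1) - c n) * x := by
    change (c (n + 1) - c n) * x * a (n + 1) = _
    linear_combination (x : R) * hsub n
  calc ((π (s x) : span (Set.range a)) : R)
      = ∑ n ∈ Finset.range N, s x n * a (n + 1) := by
        simp only [π, Finsupp.linearCombination_apply]
        rw [Finsupp.sum_of_support_subset _ hsN _ (by simp)]
        simp
    _ = (c N - c 0) * x := by
        simp_rw [hterm]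
        rw [← Finset.sum_mul, Finset.sum_range_sub]
    _ = x := by
        rw [show c 0 = 0 from rfl, sub_zero, hN N le_rfl]

/-- A pure ideal contains a sequence of successive local units with any prescribed first term, whose
span contains any prescribed sequence of elements of the ideal. -/
theorem exists_seq_of_pure {I : Ideal R} (h : I.Pure) {x : R} (hx : x ∈ I) {y : ℕ → R}
    (hy : ∀ n, y n ∈ I) :
    ∃ a : ℕ → R, a 0 = x ∧ (∀ n, a n ∈ I) ∧ (∀ n, a (n + 1) * a n = a n) ∧
      ∀ n, y n ∈ span (Set.range a) := by
  have hunit := pure_iff_forall_exists_mul_eq.1 h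
  have hstep (z : I) (n : ℕ) : ∃ u : I, (u : R) * z = z ∧ (u : R) * y n = y n := by
    obtain ⟨t, ht, htz⟩ := hunit z z.2
    obtain ⟨t', ht', hty⟩ := hunit (y n) (hy n)
    obtain ⟨u, hu, huz, huy⟩ := exists_mul_eq_and_mul_eq ht htz ht' hty
    exact ⟨⟨u, hu⟩, huz, huy⟩
  choose u hu hu' using hstep
  let b : ℕ → I := Nat.rec ⟨x, hx⟩ fun n z ↦ u z n
  refine ⟨fun n ↦ (b n).1, rfl, fun n ↦ (b n).2, fun n ↦ hu (b n) n, fun n ↦ ?_⟩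
  rw [← hu' (b n) n]
  exact mul_mem_right _ _ (subset_span ⟨n + 1, rfl⟩)

theorem exists_seq_span_eq_of_pure {I : Ideal R} (hI : I.IsCountablyGenerated) (h : I.Pure) :
    ∃ a : ℕ → R, span (Set.range a) = I ∧ ∀ n, a (n + 1) * a n = a n := by
  obtain ⟨S, hS, rfl⟩ := hI
  -- Inserting `0` makes the generating set nonempty, so that a sequence enumerates it.
  obtain ⟨y, hy⟩ := (hS.insert 0).exists_eq_range (Set.insert_nonempty _ _)
  have hyI (n : ℕ) : y n ∈ span S := by
    have : y n ∈ insert 0 S := hy ▸ Set.mem_range_self n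
    rcases this with h0 | hS
    · rw [h0]
      exact zero_mem _
    · exact subset_span hS
  obtain ⟨a, -, haI, ha, hya⟩ := exists_seq_of_pure h (zero_mem _) hyI
  refine ⟨a, le_antisymm (span_le.2 ?_) (span_le.2 fun x hx ↦ ?_), ha⟩
  · rintro _ ⟨n, rfl⟩
    exact haI n
  · obtain ⟨n, rfl⟩ : x ∈ Set.range y := hy ▸ Set.mem_insert_of_mem 0 hx
    exact hya n

end Ideal

/-! ### Pure ideals as traces of projective modules -/

theorem Ideal.Pure.exists_projective_traceIdeal_eq {R : Type u} [CommRing R] {I : Ideal R}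
    (h : I.Pure) : ∃ (P : Type u) (_ : AddCommGroup P) (_ : Module R P),
      Module.Projective R P ∧ Module.traceIdeal R P = I := by
  have hseq (x : I) : ∃ a : ℕ → R, a 0 = x ∧ (∀ n, a n ∈ I) ∧ ∀ n, a (n + 1) * a n = a n := by
    obtain ⟨a, h0, haI, ha, -⟩ := exists_seq_of_pure h x.2 (y := 0) fun _ ↦ zero_mem _
    exact ⟨a, h0, haI, ha⟩
  choose a h0 haI ha using hseq
  have hproj (x : I) := projective_span_range_of_succ_mul_eq (ha x)
  refine ⟨Π₀ x : I, span (Set.range (a x)), inferInstance, inferInstance, inferInstance, ?_⟩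
  simp_rw [Module.traceIdeal_dfinsupp,
    Module.traceIdeal_of_pure (pure_span_range_of_succ_mul_eq (ha _))]
  refine le_antisymm (iSup_le fun x ↦ span_le.2 ?_) fun x hx ↦
    Ideal.mem_iSup_of_mem ⟨x, hx⟩ (subset_span ⟨0, h0 ⟨x, hx⟩⟩)
  rintro _ ⟨n, rfl⟩
  exact haI x n

theorem Submodule.IsCountablyGenerated.top_ulift {R : Type*} [CommRing R] {M : Type u}
    [AddCommGroup M] [Module R M] {N : Submodule R M} (h : N.IsCountablyGenerated) :
    (⊤ : Submodule R (ULift.{v} N)).IsCountablyGenerated := by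
  obtain ⟨S, hS, rfl⟩ := h
  let e : span R S →ₗ[R] ULift.{v} (span R S) := ULift.moduleEquiv.symm.toLinearMap
  have he : LinearMap.range e = ⊤ := LinearEquiv.range _
  refine ⟨e '' ((↑) ⁻¹' S), (hS.preimage Subtype.val_injective).image _, ?_⟩
  rw [← Submodule.map_span, Submodule.span_span_coe_preimage, Submodule.map_top, he]

theorem corollary2p13 (R : Type u) [CommRing R] (I : Ideal R) :
    -- An ideal is the trace of a projective module if and only if it is pure.
    ((∃ (P : Type (max u v)) (_ : AddCommGroup P) (_ : Module R P),
        Module.Projective R P ∧ Module.traceIdeal R P = I) ↔ I.Pure) ∧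
    -- The countably generated case.
    List.TFAE [
      ∃ (P : Type (max u v)) (_ : AddCommGroup P) (_ : Module R P),
        Module.Projective R P ∧ (⊤ : Submodule R P).IsCountablyGenerated ∧
          Module.traceIdeal R P = I,
      ∃ a : ℕ → R, Ideal.span (Set.range a) = I ∧ ∀ n, a (n + 1) * a n = a n,
      I.IsCountablyGenerated ∧ I.Pure,
      I.IsCountablyGenerated ∧ Module.Projective R I ∧ I.Pure] := by
  refine ⟨⟨?_, fun h ↦ ?_⟩, ?_⟩
  · rintro ⟨P, _, _, hP, rfl⟩
    exact Module.pure_traceIdeal_of_projective P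
  · obtain ⟨P, _, _, hP, hI⟩ := h.exists_projective_traceIdeal_eq
    exact ⟨ULift.{v} P, inferInstance, inferInstance, inferInstance,
      (Module.traceIdeal_congr ULift.moduleEquiv).trans hI⟩
  · tfae_have 1 → 3 := by
      rintro ⟨P, _, _, hP, hfg, rfl⟩
      exact ⟨Module.isCountablyGenerated_traceIdeal hfg, Module.pure_traceIdeal_of_projective P⟩
    tfae_have 3 → 2 := fun ⟨hfg, hI⟩ ↦ Ideal.exists_seq_span_eq_of_pure hfg hI
    tfae_have 2 → 4 := by
      rintro ⟨a, rfl, ha⟩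
      exact ⟨⟨_, Set.countable_range a, rfl⟩, Ideal.projective_span_range_of_succ_mul_eq ha,
        Ideal.pure_span_range_of_succ_mul_eq ha⟩
    tfae_have 4 → 1 := by
      rintro ⟨hfg, hproj, hI⟩
      exact ⟨ULift.{v} I, inferInstance, inferInstance, inferInstance, hfg.top_ulift,
        (Module.traceIdeal_congr ULift.moduleEquiv).trans (Module.traceIdeal_of_pure hI)⟩
    tfae_finish
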